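/- For $p\in[1,\infty)$ and $A\in\mathbb R^{n\times n}$ let $\|A\|_{S_p}=(\sum_i\sigma_i(A)^p)^{1/p}$ be the Schatten norm, where $\sigma_i(A)$ are the singular values of $A$; for $p=\infty$ let $\|A\|_{S_\infty}=\max_i\sigma_i(A)$. Write $\mathrm{nnz}(A)$ for the number of non-zero entries of $A$. A matrix $A'\in\mathbb R^{n\times n}$ is an $(\epsilon,S_p)$-norm approximation of $A$ if $\|A-A'\|_{S_p}\le\epsilon\|A\|_{S_p}$, and it is an $(\epsilon,S_p,s)$-norm sparsifier of $A$ if moreover $\mathrm{nnz}(A')\le s$. Theorem 2. Fix $p\ne q$ in $[1,\infty]$ (with $1/\infty=0$). There are constants $C,c>0$ and $k\in\mathbb N$, depending only on $p$ and $q$, such that for every integer $n\ge 2$ and all real $\epsilon,\epsilon_0$ with $(\log_2 n)^{-|1/q-1/p|}<\epsilon\le\epsilon_0\le 0.1$ there is a matrix $A\in\mathbb R^{n\times n}$ that has an $(\epsilon,S_p,Cn)$-norm sparsifier, while every $(\epsilon_0,S_q)$-norm approximation $\tilde A$ of $A$ satisfies $\mathrm{nnz}(\tilde A)\ge c\,n^2/(\log_2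 n)^k$ (that is, it has $\tilde\Omega(n^2)$ non-zero entries). -/

import Mathlib

open scoped ENNReal

noncomputable section

/-- Number of non-zero entries of a matrix. -/
def nnz {m d : ℕ} (A : Matrix (Fin m) (Fin d) ℝ) : ℕ :=
  (Finset.univ.filter fun ij : Fin m × Fin d => A ij.1 ij.2 ≠ 0).card

/-- The Schatten `p`-norm: the `ℓ_p` norm of the vector of singular values of `A`, where `A` is seen
as a linear map between Euclidean spaces. It is `(∑ σ_i ^ p) ^ (1 / p)` for finite `p > 0`,
and the largest singular value (the spectral norm) for `p = ∞`. -/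
def schattenNorm (p : ℝ≥0∞) {m d : ℕ} (A : Matrix (Fin m) (Fin d) ℝ) : ℝ :=
  ‖(WithLp.toLp p fun i : Fin d => (Matrix.toEuclideanLin A).singularValues i :
    PiLp p fun _ : Fin d => ℝ)‖

/-- `A'` is an `(ε, S_p)`-norm approximation of `A`. -/
def IsSchattenApprox (ε : ℝ) (p : ℝ≥0∞) {m d : ℕ} (A A' : Matrix (Fin m) (Fin d) ℝ) : Prop :=
  schattenNorm p (A - A') ≤ ε * schattenNorm p A

/-- `A'` is an `(ε, S_p, s)`-norm sparsifier of `A`. -/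
def IsSchattenSparsifier (ε : ℝ) (p : ℝ≥0∞) (s : ℝ) {m d : ℕ}
    (A A' : Matrix (Fin m) (Fin d) ℝ) : Prop :=
  IsSchattenApprox ε p A A' ∧ (nnz A' : ℝ) ≤ s

end

/-!
The matrix `A` is block diagonal, `A = D ⊕ a • 1`, with `D` a dense `m × m` contraction and
`1` the identity of size `t`, where `m + t = n`. Up to constants, `D` has `S_r`-norm `m ^ (1 / r)`
for every `r`, and the scalar block has `S_r`-norm `a * t ^ (1 / r)`. Taking
`a = (m / t) ^ (1 / q)` makes the two blocks equally heavy in `S_q`, so that an approximation of `A`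
in `S_q` has to approximate `D`; the relative weight of `D` in `S_p` is then
`(m / t) ^ (1 / p - 1 / q)`. Let `L = log₂ n`. If the smaller of the two blocks, namely `D` when
`p < q` and the scalar block when `q < p`, is `1 / L` times the size of the other, this weight is
at most `L ^ (-|1 / q - 1 / p|)`, and the scalar block alone, with at most `n` non-zero entries,
approximates `A` in `S_p` (`exists_separating_matrix`).

Norms of blocks are handled without computing singular values: if `X = U Σ Vᵀ` and `Z` is an
`m × m` contraction placed on some `m` coordinates, then the diagonal entries of `Uᵀ Z V` are
at most `1` in absolute value and their absolute values sum to at most `m`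
(`diag_compression_le`). This gives Hölder's inequality `⟪X, Z⟫ ≤ m ^ (1 - 1 / q) ‖X‖_{S_q}`
(`frob_le_schattenNorm`) and the upper bounds (`schattenNorm_blocks_le`). By Hölder's inequality,
it is enough that `D` is far from every sparse matrix in the nuclear norm `S_1`.

Such a `D` comes from counting (`exists_signMatrix_far`). Suppose that every `m × m` sign matrix is
within `m ^ (3 / 2) / 2` of a matrix with at most `s` non-zero entries, `s` being a small multiple
of `m ^ 2 / L`. After rounding to integers only `exp (O(s L))` sparse matrices are needed, so one of
them, `E`, serves a fraction `exp (-κ m ^ 2)` of all sign matrices, with `κ` small. By concentration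
of measure (`sum_distTo_le`) the average Hamming distance to this set of sign matrices is a small
multiple of `m ^ 2`, and since changing `d` signs moves the nuclear norm by at most `2 √(m d)`,
the average of `‖S - E‖_{S_1}` over all sign matrices `S` is close to `m ^ (3 / 2) / 2`
(`sum_nuclear_sub_le`). But this average is at least the average of `‖S‖_{S_1}`, by the symmetry
`S ↦ -S`, and that is at least `(19 / 27) m ^ (3 / 2)` by a fourth moment computation
(`sum_nuclear_signMatrix_ge`), a contradiction. Finally, clipping the singular values of the sign
matrix at `√m` changes it by at most `m ^ (3 / 2) / 4` and turns it into a multiple of a contraction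
(`exists_contraction_far`).
-/

open Matrix

/-! ### Singular value decomposition and Schatten norms -/

noncomputable section

/-- The Frobenius inner product `⟪X, Y⟫ = tr (Xᵀ Y)`. -/
def frob {n : ℕ} (X Y : Matrix (Fin n) (Fin n) ℝ) : ℝ := trace (Xᵀ * Y)

/-- `Y` has operator norm at most one. In the form used here, the bound `⟪x, Y y⟫ ≤ ‖x‖ ‖y‖` is
replaced by the equivalent `2 ⟪x, Y y⟫ ≤ ‖x‖ ^ 2 + ‖y‖ ^ 2`, which involves no square roots. -/
def IsContraction {n : ℕ} (Y : Matrix (Fin n) (Fin n) ℝ) : Prop :=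
  ∀ x y : Fin n → ℝ, 2 * (x ⬝ᵥ Y *ᵥ y) ≤ x ⬝ᵥ x + y ⬝ᵥ y

end

/-- Singular value decomposition, with the singular values that define `schattenNorm`: `V` collects
an eigenbasis of `Xᵀ X`, and `U` extends the normalized images of its vectors to an orthonormal
basis. -/
theorem exists_svd {n : ℕ} (X : Matrix (Fin n) (Fin n) ℝ) :
    ∃ U V : Matrix (Fin n) (Fin n) ℝ, Uᵀ * U = 1 ∧ Vᵀ * V = 1 ∧
      X = U * diagonal (fun i : Fin n => (toEuclideanLin X).singularValues i) * Vᵀ := by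
  set T := toEuclideanLin X with hT
  have hn : Module.finrank ℝ (EuclideanSpace ℝ (Fin n)) = n := by simp
  set v := T.isSymmetric_adjoint_comp_self.eigenvectorBasis hn with hv
  set σ : Fin n → ℝ := fun i => T.singularValues i with hσ
  have hinner : ∀ i j, inner ℝ (T (v i)) (T (v j)) = if i = j then σ i ^ 2 else 0 := by
    intro i j
    rw [← LinearMap.adjoint_inner_right, ← LinearMap.comp_apply,
      T.isSymmetric_adjoint_comp_self.apply_eigenvectorBasis hn j, ← T.sq_singularValues_fin hn j,
      real_inner_smul_right, orthonormal_iff_ite.mp v.orthonormal i j]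
    split_ifs with h
    · subst h; simp [hσ]
    · simp
  obtain ⟨u, hu⟩ := Orthonormal.exists_orthonormalBasis_extension_of_card_eq (𝕜 := ℝ)
    (E := EuclideanSpace ℝ (Fin n)) (ι := Fin n) (by simp)
    (v := fun i => (σ i)⁻¹ • T (v i)) (s := {i | σ i ≠ 0}) (by
      rw [orthonormal_iff_ite]
      rintro ⟨i, hi⟩ ⟨j, hj⟩
      simp only [Set.domRestrict_apply, real_inner_smul_left, real_inner_smul_right, hinner,
        Subtype.mk.injEq]
      split_ifs with h
      · subst h
        have : σ i ≠ 0 := hi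
        field_simp
      · simp)
  have hTv : ∀ i, T (v i) = σ i • u i := by
    intro i
    by_cases h : σ i = 0
    · have := hinner i i
      rw [if_pos rfl, h] at this
      rw [h, zero_smul, ← inner_self_eq_zero (𝕜 := ℝ), this]
      simp
    · rw [hu i h, smul_smul, mul_inv_cancel₀ h, one_smul]
  let U : Matrix (Fin n) (Fin n) ℝ := of fun k i => u i k
  let V : Matrix (Fin n) (Fin n) ℝ := of fun k i => v i k
  have horth : ∀ w : OrthonormalBasis (Fin n) ℝ (EuclideanSpace ℝ (Fin n)),
      (of fun k i => w i k : Matrix (Fin n) (Fin n) ℝ)ᵀ * (of fun k i => w i k) = 1 := by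
    intro w
    ext i j
    have := orthonormal_iff_ite.mp w.orthonormal i j
    rw [PiLp.inner_apply] at this
    simp only [mul_apply, transpose_apply, of_apply, one_apply, ← this]
    simp [mul_comm]
  have hV : V * Vᵀ = 1 := mul_eq_one_comm.mp (horth v)
  refine ⟨U, V, horth u, horth v, ?_⟩
  have hXV : X * V = U * diagonal σ := by
    ext k i
    have := congrArg (fun z : EuclideanSpace ℝ (Fin n) => z k) (hTv i)
    simp only [hT, toLpLin_apply, PiLp.smul_apply, smul_eq_mul] at this
    rw [mul_diagonal]
    simp only [mul_apply, U, V, of_apply]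
    rw [mul_comm, ← this]
    rfl
  rw [← hXV, Matrix.mul_assoc, hV, Matrix.mul_one]

theorem frob_eq_sum {n : ℕ} (X Y : Matrix (Fin n) (Fin n) ℝ) :
    frob X Y = ∑ i, ∑ j, X i j * Y i j := by
  simp only [frob, trace, diag, mul_apply, transpose_apply]
  exact Finset.sum_comm

/-- Pairing with `Z` only sees the diagonal of `Z` written in the singular bases. -/
theorem frob_svd {n : ℕ} (U V Z : Matrix (Fin n) (Fin n) ℝ) (σ : Fin n → ℝ) :
    frob (U * diagonal σ * Vᵀ) Z = ∑ i, σ i * (Uᵀ * Z * V) i i := by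
  rw [frob, transpose_mul, transpose_mul, transpose_transpose, diagonal_transpose,
    Matrix.mul_assoc, trace_mul_comm, Matrix.mul_assoc, Matrix.mul_assoc]
  simp only [trace, diag, diagonal_mul, Matrix.mul_assoc]

/-- A contraction `Y` supported on an `m`-dimensional subspace, the range of the isometry `J`, has
diagonal entries bounded by one, and of total size at most `m`, with respect to any pair of
orthonormal bases: the `i`-th entry is at most `(‖Jᵀ uᵢ‖ ^ 2 + ‖Jᵀ vᵢ‖ ^ 2) / 2`, and
`∑ i, ‖Jᵀ uᵢ‖ ^ 2 = tr (Jᵀ J) = m`. -/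
theorem diag_compression_le {n m : ℕ} {J : Matrix (Fin n) (Fin m) ℝ} (hJ : Jᵀ * J = 1)
    {Y : Matrix (Fin m) (Fin m) ℝ} (hY : IsContraction Y) {U V : Matrix (Fin n) (Fin n) ℝ}
    (hU : Uᵀ * U = 1) (hV : Vᵀ * V = 1) :
    (∀ i, |(Uᵀ * (J * Y * Jᵀ) * V) i i| ≤ 1) ∧ ∑ i, |(Uᵀ * (J * Y * Jᵀ) * V) i i| ≤ m := by
  have hcol : ∀ W : Matrix (Fin n) (Fin n) ℝ, Wᵀ * W = 1 →
      (∀ i, (Jᵀ * W).col i ⬝ᵥ (Jᵀ * W).col i ≤ 1) ∧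
        ∑ i, (Jᵀ * W).col i ⬝ᵥ (Jᵀ * W).col i = m := by
    intro W hW
    have hW' : W * Wᵀ = 1 := mul_eq_one_comm.mp hW
    have key : ∀ i, (Jᵀ * W).col i ⬝ᵥ (Jᵀ * W).col i = ((Jᵀ * W)ᵀ * (Jᵀ * W)) i i := fun i => rfl
    constructor
    · intro i
      have h1 : (W - J * (Jᵀ * W))ᵀ * (W - J * (Jᵀ * W)) = 1 - (Jᵀ * W)ᵀ * (Jᵀ * W) := by
        have e1 : (J * (Jᵀ * W))ᵀ * (J * (Jᵀ * W)) = (Jᵀ * W)ᵀ * (Jᵀ * W) := by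
          rw [transpose_mul J, Matrix.mul_assoc, ← Matrix.mul_assoc Jᵀ J, hJ, Matrix.one_mul]
        have e2 : Wᵀ * (J * (Jᵀ * W)) = (Jᵀ * W)ᵀ * (Jᵀ * W) := by
          rw [transpose_mul, transpose_transpose, Matrix.mul_assoc]
        have e3 : (J * (Jᵀ * W))ᵀ * W = (Jᵀ * W)ᵀ * (Jᵀ * W) := by
          rw [transpose_mul J, Matrix.mul_assoc]
        rw [transpose_sub, Matrix.sub_mul, Matrix.mul_sub, Matrix.mul_sub, hW, e1, e2, e3]
        abel
      have h2 : 0 ≤ ((W - J * (Jᵀ * W))ᵀ * (W - J * (Jᵀ * W))) i i := by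
        rw [mul_apply]
        exact Finset.sum_nonneg fun k _ => mul_self_nonneg _
      rw [h1, Matrix.sub_apply, one_apply_eq] at h2
      rw [key]; linarith
    · simp only [key]
      change trace ((Jᵀ * W)ᵀ * (Jᵀ * W)) = m
      rw [trace_mul_comm, transpose_mul, transpose_transpose, Matrix.mul_assoc,
        ← Matrix.mul_assoc W, hW', Matrix.one_mul, hJ, trace_one, Fintype.card_fin]
  have hbd : ∀ i, |(Uᵀ * (J * Y * Jᵀ) * V) i i| ≤
      ((Jᵀ * U).col i ⬝ᵥ (Jᵀ * U).col i + (Jᵀ * V).col i ⬝ᵥ (Jᵀ * V).col i) / 2 := by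
    intro i
    have e : (Uᵀ * (J * Y * Jᵀ) * V) i i = (Jᵀ * U).col i ⬝ᵥ Y *ᵥ (Jᵀ * V).col i := by
      have : Uᵀ * (J * Y * Jᵀ) * V = (Jᵀ * U)ᵀ * (Y * (Jᵀ * V)) := by
        simp only [transpose_mul, transpose_transpose, Matrix.mul_assoc]
      rw [this]; rfl
    have h1 := hY ((Jᵀ * U).col i) ((Jᵀ * V).col i)
    have h2 := hY (-(Jᵀ * U).col i) ((Jᵀ * V).col i)
    rw [neg_dotProduct, neg_dotProduct, dotProduct_neg, neg_neg] at h2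
    rw [e, abs_le]
    constructor <;> linarith
  obtain ⟨hU1, hU2⟩ := hcol U hU
  obtain ⟨hV1, hV2⟩ := hcol V hV
  constructor
  · intro i
    linarith [hbd i, hU1 i, hV1 i]
  · refine (Finset.sum_le_sum fun i _ => hbd i).trans ?_
    rw [← Finset.sum_div, Finset.sum_add_distrib, hU2, hV2]
    linarith

theorem norm_toLp_le_rpow {n : ℕ} {q : ℝ≥0∞} (hq : 1 ≤ q) {w : Fin n → ℝ} {r : ℝ}
    (hw : ∀ i, |w i| ≤ 1) (hr : ∑ i, |w i| ≤ r) :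
    ‖(WithLp.toLp q w : PiLp q fun _ : Fin n => ℝ)‖ ≤ r ^ (q⁻¹).toReal := by
  have hr0 : 0 ≤ r := (Finset.sum_nonneg fun i _ => abs_nonneg _).trans hr
  rcases eq_or_ne q ∞ with rfl | hqt
  · simp only [ENNReal.inv_top, ENNReal.toReal_zero, Real.rpow_zero]
    rw [PiLp.norm_toLp, pi_norm_le_iff_of_nonneg zero_le_one]
    exact hw
  · have hq0 : 0 < q.toReal := ENNReal.toReal_pos (by positivity) hqt
    have hq1 : 1 ≤ q.toReal := by
      rw [← ENNReal.toReal_one]; exact (ENNReal.toReal_le_toReal (by simp) hqt).2 hq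
    rw [PiLp.norm_eq_sum hq0, ENNReal.toReal_inv, one_div]
    refine Real.rpow_le_rpow (Finset.sum_nonneg fun i _ => by positivity) ?_ (by positivity)
    refine (Finset.sum_le_sum fun i _ => ?_).trans hr
    rw [Real.norm_eq_abs]
    exact Real.rpow_le_self_of_le_one (abs_nonneg _) (hw i) hq1

theorem sum_mul_le_norm_toLp {n : ℕ} {q : ℝ≥0∞} (hq : 1 ≤ q) {σ w : Fin n → ℝ} {r : ℝ}
    (hσ : ∀ i, 0 ≤ σ i) (hw : ∀ i, |w i| ≤ 1) (hr : ∑ i, |w i| ≤ r) :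
    ∑ i, σ i * w i ≤
      r ^ (1 - (q⁻¹).toReal) * ‖(WithLp.toLp q σ : PiLp q fun _ : Fin n => ℝ)‖ := by
  have hs0 : 0 ≤ ∑ i, |w i| := Finset.sum_nonneg fun i _ => abs_nonneg _
  have hr0 : 0 ≤ r := hs0.trans hr
  have h1 : ∑ i, σ i * w i ≤ ∑ i, |w i| * σ i := Finset.sum_le_sum fun i _ => by
    rw [mul_comm]; exact mul_le_mul_of_nonneg_right (le_abs_self _) (hσ i)
  refine h1.trans ?_
  rcases eq_or_ne q ∞ with rfl | hqt
  · simp only [ENNReal.inv_top, ENNReal.toReal_zero, sub_zero, Real.rpow_one]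
    rw [PiLp.norm_toLp]
    refine (Finset.sum_le_sum fun i _ => mul_le_mul_of_nonneg_left
      ((le_abs_self _).trans (norm_le_pi_norm σ i)) (abs_nonneg _)).trans ?_
    rw [← Finset.sum_mul]
    exact mul_le_mul_of_nonneg_right hr (norm_nonneg _)
  · have hq0 : 0 < q.toReal := ENNReal.toReal_pos (by positivity) hqt
    have hq1 : 1 ≤ q.toReal := by
      rw [← ENNReal.toReal_one]; exact (ENNReal.toReal_le_toReal (by simp) hqt).2 hq
    have h2 := Real.inner_le_weight_mul_Lp_of_nonneg Finset.univ hq1 (fun i => |w i|) σ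
      (fun i => abs_nonneg _) hσ
    refine h2.trans ?_
    rw [PiLp.norm_eq_sum hq0, ENNReal.toReal_inv, one_div]
    have : 0 ≤ 1 - q.toReal⁻¹ := sub_nonneg.2 (inv_le_one_of_one_le₀ hq1)
    refine mul_le_mul (Real.rpow_le_rpow hs0 hr this)
      (Real.rpow_le_rpow (Finset.sum_nonneg fun i _ =>
        mul_nonneg (abs_nonneg _) (Real.rpow_nonneg (hσ i) _)) ?_ (by positivity))
      (Real.rpow_nonneg (Finset.sum_nonneg fun i _ =>
        mul_nonneg (abs_nonneg _) (Real.rpow_nonneg (hσ i) _)) _) (Real.rpow_nonneg hr0 _)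
    refine Finset.sum_le_sum fun i _ => ?_
    rw [Real.norm_of_nonneg (hσ i)]
    exact mul_le_of_le_one_left (Real.rpow_nonneg (hσ i) _) (hw i)

/-- Hölder's inequality for the Schatten norms, against a contraction of rank at most `m`. -/
theorem frob_le_schattenNorm {n m : ℕ} {q : ℝ≥0∞} (hq : 1 ≤ q) {J : Matrix (Fin n) (Fin m) ℝ}
    (hJ : Jᵀ * J = 1) {Y : Matrix (Fin m) (Fin m) ℝ} (hY : IsContraction Y)
    (X : Matrix (Fin n) (Fin n) ℝ) :
    frob X (J * Y * Jᵀ) ≤ (m : ℝ) ^ (1 - (q⁻¹).toReal) * schattenNorm q X := by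
  obtain ⟨U, V, hU, hV, hX⟩ := exists_svd X
  obtain ⟨h1, h2⟩ := diag_compression_le hJ hY hU hV
  conv_lhs => rw [hX]
  rw [frob_svd]
  exact sum_mul_le_norm_toLp hq (fun i => LinearMap.singularValues_nonneg _ _) h1 h2

theorem singularValues_eq_diag {n : ℕ} {X U V : Matrix (Fin n) (Fin n) ℝ} {σ : Fin n → ℝ}
    (hU : Uᵀ * U = 1) (hV : Vᵀ * V = 1) (hX : X = U * diagonal σ * Vᵀ) (i : Fin n) :
    σ i = (Uᵀ * X * V) i i := by
  have : Uᵀ * X * V = diagonal σ := by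
    rw [hX, ← Matrix.mul_assoc, ← Matrix.mul_assoc, hU, Matrix.one_mul, Matrix.mul_assoc, hV,
      Matrix.mul_one]
  rw [this, diagonal_apply_eq]

/-- Upper bound for the Schatten norm of a combination of two low-rank contractions. The singular
values are diagonal entries of `Uᵀ X V`, so the triangle inequality of `ℓ_q` suffices and that of
`S_q` is not needed. -/
theorem schattenNorm_blocks_le {n m t : ℕ} {q : ℝ≥0∞} (hq : 1 ≤ q) {J : Matrix (Fin n) (Fin m) ℝ}
    {J' : Matrix (Fin n) (Fin t) ℝ} (hJ : Jᵀ * J = 1) (hJ' : J'ᵀ * J' = 1)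
    {Y : Matrix (Fin m) (Fin m) ℝ} {Y' : Matrix (Fin t) (Fin t) ℝ} (hY : IsContraction Y)
    (hY' : IsContraction Y') {a b : ℝ} (ha : 0 ≤ a) (hb : 0 ≤ b) :
    schattenNorm q (a • (J * Y * Jᵀ) + b • (J' * Y' * J'ᵀ)) ≤
      a * (m : ℝ) ^ (q⁻¹).toReal + b * (t : ℝ) ^ (q⁻¹).toReal := by
  obtain ⟨U, V, hU, hV, hX⟩ := exists_svd (a • (J * Y * Jᵀ) + b • (J' * Y' * J'ᵀ))
  obtain ⟨h1, h2⟩ := diag_compression_le hJ hY hU hV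
  obtain ⟨h1', h2'⟩ := diag_compression_le hJ' hY' hU hV
  have : Fact (1 ≤ q) := ⟨hq⟩
  have e : (fun i : Fin n => (toEuclideanLin (a • (J * Y * Jᵀ) +
      b • (J' * Y' * J'ᵀ))).singularValues i) =
      a • (fun i => (Uᵀ * (J * Y * Jᵀ) * V) i i) +
        b • (fun i => (Uᵀ * (J' * Y' * J'ᵀ) * V) i i) := by
    funext i
    rw [singularValues_eq_diag (σ := fun i : Fin n => (toEuclideanLin (a • (J * Y * Jᵀ) +
      b • (J' * Y' * J'ᵀ))).singularValues i) hU hV hX i]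
    simp [Matrix.mul_add, Matrix.add_mul]
  rw [schattenNorm, e, WithLp.toLp_add, WithLp.toLp_smul, WithLp.toLp_smul]
  refine (norm_add_le _ _).trans (add_le_add ?_ ?_)
  · rw [norm_smul, Real.norm_of_nonneg ha]
    exact mul_le_mul_of_nonneg_left (norm_toLp_le_rpow hq h1 h2) ha
  · rw [norm_smul, Real.norm_of_nonneg hb]
    exact mul_le_mul_of_nonneg_left (norm_toLp_le_rpow hq h1' h2') hb

/-! ### The nuclear norm -/

theorem schattenNorm_one {n : ℕ} (X : Matrix (Fin n) (Fin n) ℝ) :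
    schattenNorm 1 X = ∑ i : Fin n, (toEuclideanLin X).singularValues i := by
  rw [schattenNorm, PiLp.norm_eq_sum (by simp)]
  simp [abs_of_nonneg, LinearMap.singularValues_nonneg]

theorem frob_sub_left {n : ℕ} (X X' Y : Matrix (Fin n) (Fin n) ℝ) :
    frob (X - X') Y = frob X Y - frob X' Y := by
  simp [frob, Matrix.sub_mul]

theorem frob_add_left {n : ℕ} (X X' Y : Matrix (Fin n) (Fin n) ℝ) :
    frob (X + X') Y = frob X Y + frob X' Y := by
  simp [frob, Matrix.add_mul]

theorem frob_smul_left {n : ℕ} (a : ℝ) (X Y : Matrix (Fin n) (Fin n) ℝ) :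
    frob (a • X) Y = a * frob X Y := by
  simp [frob]

theorem dotProduct_mulVec_svd {n : ℕ} (U V : Matrix (Fin n) (Fin n) ℝ) (w x y : Fin n → ℝ) :
    x ⬝ᵥ (U * diagonal w * Vᵀ) *ᵥ y = ∑ i, (Uᵀ *ᵥ x) i * (w i * (Vᵀ *ᵥ y) i) := by
  rw [← mulVec_mulVec, ← mulVec_mulVec, dotProduct_mulVec, ← mulVec_transpose]
  simp only [dotProduct, mulVec_diagonal]

theorem IsContraction.of_svd {n : ℕ} {U V : Matrix (Fin n) (Fin n) ℝ} (hU : Uᵀ * U = 1)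
    (hV : Vᵀ * V = 1) {w : Fin n → ℝ} (hw : ∀ i, |w i| ≤ 1) :
    IsContraction (U * diagonal w * Vᵀ) := by
  intro x y
  have hnorm : ∀ (W : Matrix (Fin n) (Fin n) ℝ) (z : Fin n → ℝ), Wᵀ * W = 1 →
      z ⬝ᵥ z = ∑ i, (Wᵀ *ᵥ z) i ^ 2 := by
    intro W z hW
    have : W * Wᵀ = 1 := mul_eq_one_comm.mp hW
    calc z ⬝ᵥ z = z ⬝ᵥ (W * Wᵀ) *ᵥ z := by rw [this, one_mulVec]
      _ = (Wᵀ *ᵥ z) ⬝ᵥ (Wᵀ *ᵥ z) := by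
        rw [← mulVec_mulVec, dotProduct_mulVec, ← mulVec_transpose]
      _ = _ := by simp [dotProduct, pow_two]
  rw [dotProduct_mulVec_svd, hnorm U x hU, hnorm V y hV, Finset.mul_sum, ← Finset.sum_add_distrib]
  refine Finset.sum_le_sum fun i _ => ?_
  obtain ⟨h1, h2⟩ := abs_le.1 (hw i)
  set a := (Uᵀ *ᵥ x) i
  set b := (Vᵀ *ᵥ y) i
  have : 0 ≤ (1 + w i) * (a - b) ^ 2 + (1 - w i) * (a + b) ^ 2 :=
    add_nonneg (mul_nonneg (by linarith) (sq_nonneg _)) (mul_nonneg (by linarith) (sq_nonneg _))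
  nlinarith

theorem isContraction_one {n : ℕ} : IsContraction (1 : Matrix (Fin n) (Fin n) ℝ) := by
  have := IsContraction.of_svd (n := n) (U := 1) (V := 1) (w := fun _ => 1) (by simp) (by simp)
    (by simp)
  simpa using this

theorem IsContraction.neg {n : ℕ} {Y : Matrix (Fin n) (Fin n) ℝ} (hY : IsContraction Y) :
    IsContraction (-Y) := by
  intro x y
  have := hY x (-y)
  simpa [mulVec_neg, neg_mulVec] using this

theorem frob_le_nuclear {n : ℕ} (X : Matrix (Fin n) (Fin n) ℝ) {Y : Matrix (Fin n) (Fin n) ℝ}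
    (hY : IsContraction Y) : frob X Y ≤ schattenNorm 1 X := by
  simpa using frob_le_schattenNorm (q := 1) le_rfl (J := (1 : Matrix (Fin n) (Fin n) ℝ))
    (by simp) hY X

/-- Together with `frob_le_nuclear`: the nuclear norm is dual to the operator norm, and the supremum
is attained, at `U Vᵀ`. -/
theorem exists_contraction_frob_eq {n : ℕ} (X : Matrix (Fin n) (Fin n) ℝ) :
    ∃ Y, IsContraction Y ∧ frob X Y = schattenNorm 1 X := by
  obtain ⟨U, V, hU, hV, hX⟩ := exists_svd X
  refine ⟨U * diagonal (fun _ => 1) * Vᵀ, .of_svd hU hV (by simp), ?_⟩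
  conv_lhs => rw [hX]
  rw [frob_svd, schattenNorm_one]
  refine Finset.sum_congr rfl fun i _ => ?_
  rw [← singularValues_eq_diag (σ := fun _ => (1 : ℝ)) hU hV rfl i, mul_one]

theorem nuclear_add_le {n : ℕ} (X X' : Matrix (Fin n) (Fin n) ℝ) :
    schattenNorm 1 (X + X') ≤ schattenNorm 1 X + schattenNorm 1 X' := by
  obtain ⟨Y, hY, h⟩ := exists_contraction_frob_eq (X + X')
  rw [← h, frob_add_left]
  exact add_le_add (frob_le_nuclear X hY) (frob_le_nuclear X' hY)

theorem nuclear_sub_le {n : ℕ} (X X' : Matrix (Fin n) (Fin n) ℝ) :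
    schattenNorm 1 (X - X') ≤ schattenNorm 1 X + schattenNorm 1 X' := by
  obtain ⟨Y, hY, h⟩ := exists_contraction_frob_eq (X - X')
  have h' := frob_le_nuclear X' hY.neg
  have e : frob X' (-Y) = - frob X' Y := by simp [frob]
  rw [← h, frob_sub_left]
  linarith [frob_le_nuclear X hY]

theorem frob_self_eq_sum_sq {n : ℕ} {X U V : Matrix (Fin n) (Fin n) ℝ} {σ : Fin n → ℝ}
    (hU : Uᵀ * U = 1) (hV : Vᵀ * V = 1) (hX : X = U * diagonal σ * Vᵀ) :
    frob X X = ∑ i, σ i ^ 2 := by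
  conv_lhs => lhs; rw [hX]
  rw [frob_svd]
  refine Finset.sum_congr rfl fun i _ => ?_
  rw [← singularValues_eq_diag hU hV hX i, pow_two]

theorem frob_gram_eq_sum_pow {n : ℕ} {X U V : Matrix (Fin n) (Fin n) ℝ} {σ : Fin n → ℝ}
    (hU : Uᵀ * U = 1) (hV : Vᵀ * V = 1) (hX : X = U * diagonal σ * Vᵀ) :
    frob (Xᵀ * X) (Xᵀ * X) = ∑ i, σ i ^ 4 := by
  have : Xᵀ * X = V * diagonal (fun i => σ i ^ 2) * Vᵀ := by
    rw [hX, transpose_mul, transpose_mul, transpose_transpose, diagonal_transpose,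
      Matrix.mul_assoc V, Matrix.mul_assoc V]
    simp only [pow_two, ← diagonal_mul_diagonal, Matrix.mul_assoc]
    rw [← Matrix.mul_assoc Uᵀ, hU, Matrix.one_mul]
  rw [frob_self_eq_sum_sq hV hV this]
  exact Finset.sum_congr rfl fun i _ => by ring

theorem nuclear_le_sqrt {n : ℕ} (X : Matrix (Fin n) (Fin n) ℝ) :
    schattenNorm 1 X ≤ √n * √(frob X X) := by
  obtain ⟨U, V, hU, hV, hX⟩ := exists_svd X
  rw [schattenNorm_one, frob_self_eq_sum_sq hU hV hX, ← Real.sqrt_mul (Nat.cast_nonneg n)]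
  refine Real.le_sqrt_of_sq_le ?_
  have := sq_sum_le_card_mul_sum_sq (s := (Finset.univ : Finset (Fin n)))
    (f := fun i : Fin n => (toEuclideanLin X).singularValues i)
  simpa using this

/-- A lower bound for the nuclear norm by the second and fourth moments of the singular values, from
`x ≥ x ^ 2 - (4 / 27) x ^ 4` for `x ≥ 0`, where equality holds at `x = 0` and `x = 3 / 2`. -/
theorem nuclear_ge {n : ℕ} (X : Matrix (Fin n) (Fin n) ℝ) {τ : ℝ} (hτ : 0 < τ) :
    frob X X / τ - 4 / 27 * frob (Xᵀ * X) (Xᵀ * X) / τ ^ 3 ≤ schattenNorm 1 X := by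
  obtain ⟨U, V, hU, hV, hX⟩ := exists_svd X
  rw [schattenNorm_one, frob_self_eq_sum_sq hU hV hX, frob_gram_eq_sum_pow hU hV hX,
    Finset.sum_div, Finset.mul_sum, Finset.sum_div, ← Finset.sum_sub_distrib]
  refine Finset.sum_le_sum fun i _ => ?_
  have h0 := LinearMap.singularValues_nonneg (toEuclideanLin X) i
  set s := (toEuclideanLin X).singularValues i
  have : 0 ≤ s * (4 / 27) * (s - 3 / 2 * τ) ^ 2 * (s + 3 * τ) := by positivity
  have e : s - (s ^ 2 / τ - 4 / 27 * s ^ 4 / τ ^ 3) =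
      s * (4 / 27) * (s - 3 / 2 * τ) ^ 2 * (s + 3 * τ) / τ ^ 3 := by
    field_simp; ring
  have : 0 ≤ s - (s ^ 2 / τ - 4 / 27 * s ^ 4 / τ ^ 3) := by rw [e]; positivity
  linarith

/-- Clipping the singular values at `τ` costs little in nuclear norm, because
`max (σ - τ) 0 ≤ σ ^ 2 / (4 τ)`. -/
theorem exists_clip {n : ℕ} (X : Matrix (Fin n) (Fin n) ℝ) {τ : ℝ} (hτ : 0 < τ) :
    ∃ Z, IsContraction Z ∧ schattenNorm 1 (X - τ • Z) ≤ frob X X / (4 * τ) := by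
  obtain ⟨U, V, hU, hV, hX⟩ := exists_svd X
  have hσ : ∀ i, 0 ≤ (toEuclideanLin X).singularValues i :=
    fun i => LinearMap.singularValues_nonneg _ _
  generalize hs : (fun i : Fin n => (toEuclideanLin X).singularValues i) = σ at hX
  replace hσ : ∀ i, 0 ≤ σ i := fun i => by rw [← hs]; exact hσ i
  have hF := frob_self_eq_sum_sq hU hV hX
  refine ⟨U * diagonal (fun i => min (σ i) τ / τ) * Vᵀ, .of_svd hU hV fun i => ?_, ?_⟩
  · rw [abs_of_nonneg (div_nonneg (le_min (hσ i) hτ.le) hτ.le), div_le_one hτ]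
    exact min_le_right _ _
  · have e : X - τ • (U * diagonal (fun i => min (σ i) τ / τ) * Vᵀ) =
        U * diagonal (fun i => σ i - min (σ i) τ) * Vᵀ := by
      have : diagonal (fun i => σ i - min (σ i) τ) =
          diagonal σ - τ • diagonal (fun i => min (σ i) τ / τ) := by
        ext i j
        by_cases h : i = j
        · subst h; simp; field_simp
        · simp [h]
      rw [this, Matrix.mul_sub, Matrix.sub_mul, ← hX]
      simp
    obtain ⟨Y, hY, h⟩ := exists_contraction_frob_eq
      (X - τ • (U * diagonal (fun i => min (σ i) τ / τ) * Vᵀ))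
    have hd := (diag_compression_le (J := (1 : Matrix (Fin n) (Fin n) ℝ)) (by simp) hY hU hV).1
    simp only [Matrix.one_mul, transpose_one, Matrix.mul_one] at hd
    rw [← h, e, frob_svd, hF, Finset.sum_div]
    refine Finset.sum_le_sum fun i _ => ?_
    have h0 : 0 ≤ σ i - min (σ i) τ := sub_nonneg.2 (min_le_left _ _)
    refine (mul_le_mul_of_nonneg_left ((le_abs_self _).trans (hd i)) h0).trans ?_
    rw [mul_one, le_div_iff₀ (by positivity)]
    rcases le_total (σ i) τ with h | h
    · rw [min_eq_left h, sub_self, zero_mul]; positivity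
    · rw [min_eq_right h]; nlinarith [sq_nonneg (σ i - 2 * τ)]

theorem abs_apply_le_nuclear {n : ℕ} (X : Matrix (Fin n) (Fin n) ℝ) (i j : Fin n) :
    |X i j| ≤ schattenNorm 1 X := by
  have hc : IsContraction (single i j (1 : ℝ)) := by
    intro x y
    have e : x ⬝ᵥ single i j (1 : ℝ) *ᵥ y = x i * y j := by
      simp [single_mulVec, dotProduct, Function.update_apply]
    rw [e]
    have h1 : x i * x i ≤ x ⬝ᵥ x :=
      Finset.single_le_sum (f := fun k => x k * x k) (fun k _ => mul_self_nonneg _)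
        (Finset.mem_univ i)
    have h2 : y j * y j ≤ y ⬝ᵥ y :=
      Finset.single_le_sum (f := fun k => y k * y k) (fun k _ => mul_self_nonneg _)
        (Finset.mem_univ j)
    nlinarith [sq_nonneg (x i - y j)]
  have e : frob X (single i j (1 : ℝ)) = X i j := by
    rw [frob, trace_mul_single]; simp
  have e' : frob X (-single i j (1 : ℝ)) = - X i j := by
    rw [← e]; simp [frob]
  rw [abs_le]
  constructor
  · linarith [frob_le_nuclear X hc.neg]
  · linarith [frob_le_nuclear X hc]

/-! ### Concentration of measure on the Boolean cube -/

theorem exp_add_exp_le (a b : ℝ) {c : ℝ} (h : |a - b| ≤ c) :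
    Real.exp a + Real.exp b ≤ 2 * (Real.exp (c ^ 2 / 8) * Real.exp ((a + b) / 2)) := by
  have e : Real.exp a + Real.exp b = 2 * (Real.cosh ((a - b) / 2) * Real.exp ((a + b) / 2)) := by
    rw [Real.cosh_eq, show Real.exp a = Real.exp ((a - b) / 2) * Real.exp ((a + b) / 2) by
      rw [← Real.exp_add]; ring_nf, show Real.exp b = Real.exp (-((a - b) / 2)) *
      Real.exp ((a + b) / 2) by rw [← Real.exp_add]; ring_nf]
    ring
  rw [e]
  have h1 : Real.cosh ((a - b) / 2) ≤ Real.exp (c ^ 2 / 8) := by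
    refine (Real.cosh_le_exp_half_sq _).trans (Real.exp_le_exp.2 ?_)
    have := sq_le_sq' (abs_le.1 h).1 (abs_le.1 h).2
    linarith [show ((a - b) / 2) ^ 2 / 2 = (a - b) ^ 2 / 8 by ring]
  gcongr

theorem sum_bool_fun_succ {M : Type*} [AddCommMonoid M] {N : ℕ} (f : (Fin (N + 1) → Bool) → M) :
    ∑ x, f x = ∑ x : Fin N → Bool, (f (Fin.cons true x) + f (Fin.cons false x)) := by
  rw [← (Fin.consEquiv fun _ : Fin (N + 1) => Bool).sum_comp, Fintype.sum_prod_type,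
    Fintype.sum_bool, ← Finset.sum_add_distrib]
  rfl

/-- The bounded differences inequality on the cube, by averaging over one coordinate at a time. -/
theorem sum_exp_le_of_lipschitz_fin {c : ℝ} (N : ℕ) (f : (Fin N → Bool) → ℝ)
    (hf : ∀ x y, |f x - f y| ≤ c * hammingDist x y) :
    ∑ x, Real.exp (f x) ≤
      2 ^ N * Real.exp (N * (c ^ 2 / 8) + (∑ x, f x) / 2 ^ N) := by
  induction N with
  | zero => simp
  | succ N ih =>
    have hdist : ∀ (b : Bool) (x y : Fin N → Bool),
        hammingDist (Fin.cons b x : Fin (N + 1) → Bool) (Fin.cons b y) = hammingDist x y := by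
      intro b x y
      simp [hammingDist, Finset.card_filter, Fin.sum_univ_succ]
    have hdist' : ∀ (x : Fin N → Bool),
        hammingDist (Fin.cons true x : Fin (N + 1) → Bool) (Fin.cons false x) = 1 := by
      intro x
      simp [hammingDist, Finset.card_filter, Fin.sum_univ_succ]
    have h1 := ih (fun x => (f (Fin.cons true x) + f (Fin.cons false x)) / 2) (by
      intro x y
      have h1 := hf (Fin.cons true x) (Fin.cons true y)
      have h2 := hf (Fin.cons false x) (Fin.cons false y)
      rw [hdist] at h1 h2
      rw [abs_le] at *
      constructor <;> linarith [h1.1, h1.2, h2.1, h2.2])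
    rw [sum_bool_fun_succ, sum_bool_fun_succ]
    have h2 : ∀ x : Fin N → Bool, Real.exp (f (Fin.cons true x)) + Real.exp (f (Fin.cons false x))
        ≤ 2 * Real.exp (c ^ 2 / 8) *
          Real.exp ((f (Fin.cons true x) + f (Fin.cons false x)) / 2) := by
      intro x
      rw [mul_assoc]
      refine exp_add_exp_le _ _ ?_
      simpa [hdist'] using hf (Fin.cons true x) (Fin.cons false x)
    refine (Finset.sum_le_sum fun x _ => h2 x).trans ?_
    rw [← Finset.mul_sum]
    refine (mul_le_mul_of_nonneg_left h1 (by positivity)).trans (le_of_eq ?_)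
    rw [← Finset.sum_div, div_div, ← pow_succ']
    rw [show 2 * Real.exp (c ^ 2 / 8) * (2 ^ N * Real.exp (N * (c ^ 2 / 8) +
      (∑ x : Fin N → Bool, (f (Fin.cons true x) + f (Fin.cons false x))) / 2 ^ (N + 1))) =
      2 ^ (N + 1) * (Real.exp (c ^ 2 / 8) * Real.exp (N * (c ^ 2 / 8) +
      (∑ x : Fin N → Bool, (f (Fin.cons true x) + f (Fin.cons false x))) / 2 ^ (N + 1))) by ring,
      ← Real.exp_add]
    push_cast
    ring_nf

/-- Bounded differences inequality: a function on the cube that is `c`-Lipschitz for the Hamming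
distance is sub-Gaussian, with variance proxy `c ^ 2 / 4` per coordinate. -/
theorem sum_exp_le_of_lipschitz {ι : Type*} [Fintype ι] [DecidableEq ι] {c : ℝ}
    (f : (ι → Bool) → ℝ) (hf : ∀ x y, |f x - f y| ≤ c * hammingDist x y) :
    ∑ x, Real.exp (f x) ≤ 2 ^ Fintype.card ι *
      Real.exp (Fintype.card ι * (c ^ 2 / 8) + (∑ x, f x) / 2 ^ Fintype.card ι) := by
  let e : ι ≃ Fin (Fintype.card ι) := Fintype.equivFin ι
  let φ : (Fin (Fintype.card ι) → Bool) ≃ (ι → Bool) := e.symm.arrowCongr (Equiv.refl Bool)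
  rw [← φ.sum_comp, ← φ.sum_comp f]
  refine sum_exp_le_of_lipschitz_fin _ (fun x => f (φ x)) fun x y => ?_
  have : hammingDist (φ x) (φ y) = hammingDist x y := by
    simp only [hammingDist]
    refine Finset.card_equiv e fun i => ?_
    simp [φ]
  rw [← this]
  exact hf _ _

noncomputable section

/-- The Hamming distance from a point of the cube to a nonempty set. -/
def distTo {ι : Type*} [Fintype ι] {B : Finset (ι → Bool)} (hB : B.Nonempty)
    (x : ι → Bool) : ℕ :=
  B.inf' hB fun b => hammingDist x b

end

theorem distTo_le {ι : Type*} [Fintype ι] {B : Finset (ι → Bool)} (hB : B.Nonempty)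
    {b : ι → Bool} (hb : b ∈ B) (x : ι → Bool) : distTo hB x ≤ hammingDist x b :=
  Finset.inf'_le _ hb

theorem exists_distTo_eq {ι : Type*} [Fintype ι] {B : Finset (ι → Bool)} (hB : B.Nonempty)
    (x : ι → Bool) : ∃ b ∈ B, distTo hB x = hammingDist x b :=
  Finset.exists_mem_eq_inf' hB _

theorem distTo_le_add {ι : Type*} [Fintype ι] {B : Finset (ι → Bool)} (hB : B.Nonempty)
    (x y : ι → Bool) : distTo hB x ≤ hammingDist x y + distTo hB y := by
  obtain ⟨b, hb, h⟩ := exists_distTo_eq hB y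
  rw [h]
  exact (distTo_le hB hb x).trans (hammingDist_triangle x y b)

/-- A set that fills a proportion at least `exp (-κ N)` of the `N`-dimensional cube is at average
distance at most `N (c / 8 + κ / c)` from a point of the cube: apply the bounded differences
inequality to `-c` times the distance, whose exponential is `1` on the set. -/
theorem sum_distTo_le {ι : Type*} [Fintype ι] [DecidableEq ι] {B : Finset (ι → Bool)}
    (hB : B.Nonempty) {κ c : ℝ} (hc : 0 < c)
    (hcard : 2 ^ Fintype.card ι ≤ B.card * Real.exp (κ * Fintype.card ι)) :
    ∑ x, (distTo hB x : ℝ) ≤ 2 ^ Fintype.card ι * (Fintype.card ι * (c / 8 + κ / c)) := by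
  set N := Fintype.card ι
  have h1 := sum_exp_le_of_lipschitz (c := c) (fun x => -c * distTo hB x) (by
    intro x y
    have h1 : (distTo hB x : ℝ) ≤ hammingDist x y + distTo hB y := by
      exact_mod_cast distTo_le_add hB x y
    have h2 : (distTo hB y : ℝ) ≤ hammingDist x y + distTo hB x := by
      rw [hammingDist_comm]; exact_mod_cast distTo_le_add hB y x
    rw [← mul_sub, abs_mul, abs_neg, abs_of_pos hc]
    refine mul_le_mul_of_nonneg_left (abs_le.2 ⟨?_, ?_⟩) hc.le <;> linarith)
  have h2 : (B.card : ℝ) ≤ ∑ x, Real.exp (-c * distTo hB x) := by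
    have : (B.card : ℝ) = ∑ x ∈ B, Real.exp (-c * distTo hB x) := by
      rw [Finset.card_eq_sum_ones, Nat.cast_sum]
      refine Finset.sum_congr rfl fun x hx => ?_
      have : distTo hB x = 0 := by
        have := distTo_le hB hx x
        rwa [hammingDist_self, Nat.le_zero] at this
      simp [this]
    rw [this]
    exact Finset.sum_le_sum_of_subset_of_nonneg (Finset.subset_univ B)
      fun x _ _ => (Real.exp_pos _).le
  rw [← Finset.mul_sum] at h1
  have h3 := hcard.trans (mul_le_mul_of_nonneg_right (h2.trans h1) (Real.exp_pos _).le)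
  rw [mul_assoc, ← Real.exp_add] at h3
  have h4 : 1 ≤ Real.exp (N * (c ^ 2 / 8) + (-c * ∑ x, (distTo hB x : ℝ)) / 2 ^ N + κ * N) :=
    le_of_mul_le_mul_left (by rw [mul_one]; exact h3) (by positivity : (0 : ℝ) < 2 ^ N)
  have h5 := Real.one_le_exp_iff.1 h4
  have h6 : c * ((∑ x, (distTo hB x : ℝ)) / 2 ^ N) ≤ c * (N * (c / 8 + κ / c)) := by
    have e : c * (N * (c / 8 + κ / c)) = N * (c ^ 2 / 8) + κ * N := by field_simp
    rw [e]
    have : (-c * ∑ x, (distTo hB x : ℝ)) / 2 ^ N = -(c * ((∑ x, (distTo hB x : ℝ)) / 2 ^ N)) := by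
      ring
    linarith
  have h7 := le_of_mul_le_mul_left h6 hc
  rw [div_le_iff₀ (by positivity)] at h7
  linarith

/-! ### Nuclear norms of sign matrices -/

noncomputable section

/-- The matrix of signs given by a point of the cube: `1` for `true`, `-1` for `false`. -/
def signMatrix {m : ℕ} (x : Fin m × Fin m → Bool) : Matrix (Fin m) (Fin m) ℝ :=
  of fun i j => if x (i, j) then 1 else -1

end

theorem signMatrix_apply {m : ℕ} (x : Fin m × Fin m → Bool) (i j : Fin m) :
    signMatrix x i j = if x (i, j) then 1 else -1 := rfl

theorem signMatrix_mul_self {m : ℕ} (x : Fin m × Fin m → Bool) (i j : Fin m) :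
    signMatrix x i j * signMatrix x i j = 1 := by
  rw [signMatrix_apply]; split_ifs <;> norm_num

theorem frob_signMatrix_self {m : ℕ} (x : Fin m × Fin m → Bool) :
    frob (signMatrix x) (signMatrix x) = (m : ℝ) ^ 2 := by
  simp only [frob_eq_sum, signMatrix_mul_self]
  simp [pow_two]

theorem frob_signMatrix_sub {m : ℕ} (x y : Fin m × Fin m → Bool) :
    frob (signMatrix x - signMatrix y) (signMatrix x - signMatrix y) = 4 * hammingDist x y := by
  rw [frob_eq_sum, ← Fintype.sum_prod_type', hammingDist, Finset.card_filter, Nat.cast_sum,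
    Finset.mul_sum]
  refine Finset.sum_congr rfl fun p _ => ?_
  rw [Matrix.sub_apply, signMatrix_apply, signMatrix_apply]
  cases x p <;> cases y p <;> simp <;> norm_num

/-- Changing the sign of the entry `(i, j)` reverses the sign of every summand. -/
theorem sum_signMatrix_quartic_eq_zero {m : ℕ} {i i' j k : Fin m} (hi : i ≠ i') (hj : j ≠ k) :
    ∑ x : Fin m × Fin m → Bool, signMatrix x i j * signMatrix x i k *
      (signMatrix x i' j * signMatrix x i' k) = 0 := by
  have hinv : Function.Involutive
      fun x : Fin m × Fin m → Bool => Function.update x (i, j) (!x (i, j)) := by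
    intro x; simp
  have h := Equiv.sum_comp (hinv.toPerm _) (fun x : Fin m × Fin m → Bool =>
    signMatrix x i j * signMatrix x i k * (signMatrix x i' j * signMatrix x i' k))
  have h1 : ∀ x : Fin m × Fin m → Bool,
      signMatrix (Function.update x (i, j) (!x (i, j))) i j = - signMatrix x i j := by
    intro x
    rw [signMatrix_apply, signMatrix_apply]
    cases x (i, j) <;> simp
  have h2 : ∀ (x : Fin m × Fin m → Bool) (a b : Fin m), (a, b) ≠ (i, j) →
      signMatrix (Function.update x (i, j) (!x (i, j))) a b = signMatrix x a b := by
    intro x a b hab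
    rw [signMatrix_apply, signMatrix_apply, Function.update_of_ne hab]
  have h3 : ∀ x : Fin m × Fin m → Bool, (hinv.toPerm _) x =
      Function.update x (i, j) (!x (i, j)) := fun x => rfl
  simp only [h3, h1] at h
  simp only [h2 _ i k (by simp [hj.symm]), h2 _ i' j (by simp [hi.symm]),
    h2 _ i' k (by simp [hi.symm]), neg_mul, Finset.sum_neg_distrib] at h
  linarith

/-- The average of `‖S‖ ^ 4` in the Schatten `4`-norm, over all sign matrices `S`, is at most
`2 m ^ 3`. -/
theorem sum_frob_gram_signMatrix_le (m : ℕ) :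
    ∑ x : Fin m × Fin m → Bool, frob ((signMatrix x)ᵀ * signMatrix x)
      ((signMatrix x)ᵀ * signMatrix x) ≤ 2 ^ (m * m) * (2 * (m : ℝ) ^ 3) := by
  have hcard : (Finset.univ : Finset (Fin m × Fin m → Bool)).card = 2 ^ (m * m) := by
    simp
  have key : ∀ j k : Fin m, ∑ x : Fin m × Fin m → Bool,
      ((signMatrix x)ᵀ * signMatrix x) j k * ((signMatrix x)ᵀ * signMatrix x) j k ≤
      2 ^ (m * m) * ((m : ℝ) + if j = k then (m : ℝ) ^ 2 else 0) := by
    intro j k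
    simp only [mul_apply, transpose_apply]
    by_cases h : j = k
    · subst h
      simp only [signMatrix_mul_self, if_true]
      simp only [Finset.sum_const, hcard, Finset.card_fin, nsmul_eq_mul]
      push_cast
      have : (0 : ℝ) ≤ m := Nat.cast_nonneg m
      have h2 : (0 : ℝ) < 2 ^ (m * m) := by positivity
      refine mul_le_mul_of_nonneg_left ?_ h2.le
      nlinarith
    · rw [if_neg h, add_zero]
      simp only [Finset.sum_mul_sum]
      rw [Finset.sum_comm]
      have : ∀ i : Fin m, ∑ x : Fin m × Fin m → Bool, ∑ i' : Fin m,
          signMatrix x i j * signMatrix x i k * (signMatrix x i' j * signMatrix x i' k) =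
          2 ^ (m * m) := by
        intro i
        rw [Finset.sum_comm, Finset.sum_eq_single i]
        · have : ∀ x : Fin m × Fin m → Bool, signMatrix x i j * signMatrix x i k *
              (signMatrix x i j * signMatrix x i k) = 1 := by
            intro x
            rw [mul_mul_mul_comm, signMatrix_mul_self, signMatrix_mul_self, one_mul]
          simp only [this, Finset.sum_const, hcard, nsmul_eq_mul]
          push_cast; ring
        · intro i' _ hi'
          exact sum_signMatrix_quartic_eq_zero (Ne.symm hi') h
        · simp
      simp only [this]
      simp [mul_comm]
  simp only [frob_eq_sum]
  rw [Finset.sum_comm]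
  calc _ ≤ ∑ j : Fin m, ∑ k : Fin m,
        (2 : ℝ) ^ (m * m) * ((m : ℝ) + if j = k then (m : ℝ) ^ 2 else 0) := by
        refine Finset.sum_le_sum fun j _ => ?_
        rw [Finset.sum_comm]
        exact Finset.sum_le_sum fun k _ => key j k
    _ = _ := by
        simp only [← Finset.mul_sum, Finset.sum_add_distrib]
        simp
        ring

theorem sum_nuclear_signMatrix_ge {m : ℕ} (hm : 0 < m) :
    2 ^ (m * m) * (19 / 27 * (m * √m)) ≤
      ∑ x : Fin m × Fin m → Bool, schattenNorm 1 (signMatrix x) := by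
  have hm' : (0 : ℝ) < m := by exact_mod_cast hm
  have hs : 0 < √(m : ℝ) := Real.sqrt_pos.2 hm'
  have hs2 : √(m : ℝ) ^ 2 = m := Real.sq_sqrt hm'.le
  have h1 := Finset.sum_le_sum fun x (_ : x ∈ (Finset.univ : Finset (Fin m × Fin m → Bool))) =>
    nuclear_ge (signMatrix x) hs
  refine le_trans ?_ h1
  simp only [frob_signMatrix_self, Finset.sum_sub_distrib, ← Finset.sum_div, ← Finset.mul_sum]
  simp only [Finset.sum_const, Finset.card_univ, Fintype.card_fun, Fintype.card_bool,
    Fintype.card_prod, Fintype.card_fin, nsmul_eq_mul]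
  have h2 := sum_frob_gram_signMatrix_le m
  set S := ∑ x : Fin m × Fin m → Bool, frob ((signMatrix x)ᵀ * signMatrix x)
      ((signMatrix x)ᵀ * signMatrix x)
  have h3 : 4 / 27 * S / √(m : ℝ) ^ 3 ≤
      4 / 27 * (2 ^ (m * m) * (2 * (m : ℝ) ^ 3)) / √(m : ℝ) ^ 3 := by gcongr
  refine le_trans (le_of_eq ?_) (sub_le_sub_left h3 _)
  push_cast
  set r := √(m : ℝ)
  rw [← hs2]
  field_simp
  ring

theorem nuclear_signMatrix_sub_le {m : ℕ} (x y : Fin m × Fin m → Bool) :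
    schattenNorm 1 (signMatrix x - signMatrix y) ≤ 2 * √m * √(hammingDist x y) := by
  refine (nuclear_le_sqrt _).trans (le_of_eq ?_)
  rw [frob_signMatrix_sub, Real.sqrt_mul (by norm_num), show (4 : ℝ) = 2 ^ 2 by norm_num,
    Real.sqrt_sq (by norm_num)]
  ring

/-- Shifting by a fixed matrix does not decrease the average nuclear norm of a sign matrix, as
`2 S = (S - E) - (-S - E)`. -/
theorem sum_nuclear_sub_ge {m : ℕ} (E : Matrix (Fin m) (Fin m) ℝ) :
    ∑ x : Fin m × Fin m → Bool, schattenNorm 1 (signMatrix x) ≤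
      ∑ x : Fin m × Fin m → Bool, schattenNorm 1 (signMatrix x - E) := by
  have hinv : Function.Involutive fun (x : Fin m × Fin m → Bool) p => !x p := by
    intro x; simp
  have h := Equiv.sum_comp (hinv.toPerm _) (fun x => schattenNorm 1 (signMatrix x - E))
  -- Pair each sign matrix with its negative.
  have h1 : ∀ x : Fin m × Fin m → Bool, 2 * schattenNorm 1 (signMatrix x) ≤
      schattenNorm 1 (signMatrix x - E) + schattenNorm 1 (signMatrix (hinv.toPerm _ x) - E) := by
    intro x
    have e : signMatrix (hinv.toPerm _ x) = - signMatrix x := by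
      ext i j
      change signMatrix (fun p => !x p) i j = - signMatrix x i j
      rw [signMatrix_apply, signMatrix_apply]
      cases x (i, j) <;> simp
    rw [e]
    refine le_trans ?_ (nuclear_sub_le _ _)
    obtain ⟨Y, hY, h⟩ := exists_contraction_frob_eq (signMatrix x)
    rw [← h, ← frob_smul_left]
    refine le_trans (le_of_eq ?_) (frob_le_nuclear _ hY)
    congr 1
    rw [two_smul]
    abel
  have h2 := Finset.sum_le_sum fun x (_ : x ∈ (Finset.univ : Finset (Fin m × Fin m → Bool))) => h1 x
  rw [Finset.sum_add_distrib, h, ← Finset.mul_sum] at h2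
  linarith

/-- If a large set `B` of sign matrices lies within `R` of `E` in nuclear norm, then a sign matrix
is on average not much further from `E`. The parameters `β` and `c` are left free to be optimized.
-/
theorem sum_nuclear_sub_le {m : ℕ} (hm : 0 < m) {B : Finset (Fin m × Fin m → Bool)}
    {E : Matrix (Fin m) (Fin m) ℝ} {R κ c β : ℝ} (hc : 0 < c) (hβ : 0 < β)
    (hcard : 2 ^ (m * m) ≤ B.card * Real.exp (κ * (m * m)))
    (hB : ∀ b ∈ B, schattenNorm 1 (signMatrix b - E) ≤ R) :
    ∑ x : Fin m × Fin m → Bool, schattenNorm 1 (signMatrix x - E) ≤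
      2 ^ (m * m) * (R + (β + (c / 8 + κ / c) / β) * (m * √m)) := by
  have hm' : (0 : ℝ) < m := by exact_mod_cast hm
  have hne : B.Nonempty := by
    rw [Finset.nonempty_iff_ne_empty]
    rintro rfl
    have : (0 : ℝ) < 2 ^ (m * m) := by positivity
    simp at hcard
    linarith
  have h1 := sum_distTo_le (κ := κ) hne hc (by simpa using hcard)
  simp only [Fintype.card_prod, Fintype.card_fin] at h1
  have h2 : ∀ x, schattenNorm 1 (signMatrix x - E) ≤
      R + (β * (m * √m) + √m / (β * m) * distTo hne x) := by
    intro x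
    obtain ⟨b, hb, hd⟩ := exists_distTo_eq hne x
    have e : signMatrix x - E = (signMatrix b - E) + (signMatrix x - signMatrix b) := by abel
    rw [e, hd]
    refine (nuclear_add_le _ _).trans (add_le_add (hB b hb) ?_)
    refine (nuclear_signMatrix_sub_le x b).trans ?_
    set d := √(hammingDist x b : ℝ)
    have hd2 : (hammingDist x b : ℝ) = d ^ 2 := (Real.sq_sqrt (Nat.cast_nonneg _)).symm
    rw [hd2]
    -- This is `2 √m d ≤ √m (d ^ 2 / (β m) + β m)`, so that no square root of the distance is
    -- averaged.
    have e2 : β * (m * √m) + √m / (β * m) * d ^ 2 - 2 * √m * d =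
        √m / (β * m) * (d - β * m) ^ 2 := by field_simp; ring
    have : 0 ≤ √(m : ℝ) / (β * m) * (d - β * m) ^ 2 := by positivity
    linarith
  refine (Finset.sum_le_sum fun x _ => h2 x).trans ?_
  rw [Finset.sum_add_distrib, Finset.sum_add_distrib, ← Finset.mul_sum _ _ (√(m : ℝ) / (β * m))]
  simp only [Finset.sum_const, Finset.card_univ, Fintype.card_fun, Fintype.card_bool,
    Fintype.card_prod, Fintype.card_fin, nsmul_eq_mul]
  have h3 : √(m : ℝ) / (β * m) * ∑ x, (distTo hne x : ℝ) ≤ √(m : ℝ) / (β * m) *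
    (2 ^ (m * m) * (((m * m : ℕ) : ℝ) * (c / 8 + κ / c))) :=
    mul_le_mul_of_nonneg_left h1 (by positivity)
  refine (add_le_add_right (add_le_add_right h3 _) _).trans (le_of_eq ?_)
  push_cast
  field_simp

/-! ### Matrices that are far from all sparse matrices -/

/-- Rounding a sparse matrix to integers is cheap, as zero entries do not move. -/
theorem nuclear_sub_round_le {m : ℕ} (E : Matrix (Fin m) (Fin m) ℝ) :
    schattenNorm 1 (E - E.map fun a => (round a : ℝ)) ≤ √m * √(nnz E / 4) := by
  refine (nuclear_le_sqrt _).trans (mul_le_mul_of_nonneg_left (Real.sqrt_le_sqrt ?_)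
    (Real.sqrt_nonneg _))
  rw [frob_eq_sum, ← Fintype.sum_prod_type', nnz, Finset.card_filter, Nat.cast_sum,
    Finset.sum_div]
  refine Finset.sum_le_sum fun p _ => ?_
  rw [Matrix.sub_apply, map_apply]
  by_cases h : E p.1 p.2 = 0
  · simp [h]
  · have h1 := abs_sub_round (E p.1 p.2)
    obtain ⟨h2, h3⟩ := abs_le.1 h1
    simp only [ne_eq, h, not_false_eq_true, if_true, Nat.cast_one]
    nlinarith

/-- An integer-valued function with at most `s` non-zero values is encoded by `s` pairs (position,
value). The positions are distinct and contain the support. -/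
theorem exists_code {α : Type*} [Fintype α] [DecidableEq α] {s : ℕ} (hs : s ≤ Fintype.card α)
    {I : Finset ℤ} (E : α → ℤ) (hE : ∀ p, E p ∈ I)
    (hcard : (Finset.univ.filter fun p => E p ≠ 0).card ≤ s) :
    ∃ φ : Fin s → α × I, ∀ p, E p = ∑ k, if (φ k).1 = p then ((φ k).2 : ℤ) else 0 := by
  obtain ⟨T, hT, hTs⟩ := Finset.exists_superset_card_eq hcard hs
  let e : Fin s ≃ T := (T.equivFinOfCardEq hTs).symm
  refine ⟨fun k => (e k, ⟨E (e k), hE _⟩), fun p => ?_⟩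
  by_cases hp : p ∈ T
  · rw [Finset.sum_eq_single (e.symm ⟨p, hp⟩)]
    · simp
    · intro k _ hk
      rw [if_neg]
      intro h
      exact hk (by rw [Equiv.eq_symm_apply]; exact Subtype.ext h)
    · simp
  · have h0 : E p = 0 := by
      by_contra h
      exact hp (hT (by simp [h]))
    rw [h0, Finset.sum_eq_zero]
    intro k _
    rw [if_neg]
    intro h
    exact hp (h ▸ (e k).2)

/-- Some sign matrix is far, in nuclear norm, from every matrix with `s` non-zero entries, for `s`
up to a small multiple of `m ^ 2 / L`. -/
theorem exists_signMatrix_far {m s : ℕ} {L : ℝ} (hm : 0 < m) (hL : 6 ≤ L) (hmL : Real.log m ≤ L)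
    (hs : s * L ≤ 1 / 1000000 * (m : ℝ) ^ 2) :
    ∃ x : Fin m × Fin m → Bool, ∀ E : Matrix (Fin m) (Fin m) ℝ, nnz E ≤ s →
      1 / 2 * (m * √m) < schattenNorm 1 (signMatrix x - E) := by
  by_contra! hcon
  choose E hE1 hE2 using hcon
  have hm1 : (1 : ℝ) ≤ m := by exact_mod_cast hm
  have hm' : (0 : ℝ) < m := by linarith
  have hsq : √(m : ℝ) ≤ m := by
    rw [Real.sqrt_le_left hm'.le]; nlinarith
  have hs' : (s : ℝ) ≤ 1 / 6000000 * (m : ℝ) ^ 2 := by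
    have : (s : ℝ) * 6 ≤ s * L := by gcongr
    linarith
  have hsm : s ≤ m * m := by
    have : (s : ℝ) ≤ ((m * m : ℕ) : ℝ) := by push_cast; nlinarith
    exact_mod_cast this
  -- The entries of `E x` are at most `1 + m √m / 2`, so their roundings lie in `I`.
  let I : Finset ℤ := Finset.Icc (-(3 * m ^ 2 : ℕ) : ℤ) ((3 * m ^ 2 : ℕ) : ℤ)
  let F : (Fin m × Fin m → Bool) → Fin m × Fin m → ℤ := fun x p => round (E x p.1 p.2)
  have hF : ∀ x p, F x p ∈ I := by
    intro x p
    have h1 : |E x p.1 p.2| ≤ 1 + 1 / 2 * (m * √m) := by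
      have h2 := (abs_apply_le_nuclear (signMatrix x - E x) p.1 p.2).trans (hE2 x)
      have h3 : |signMatrix x p.1 p.2| = 1 := by
        rw [signMatrix_apply]; split_ifs <;> simp
      rw [Matrix.sub_apply] at h2
      have h4 := abs_sub_abs_le_abs_sub (E x p.1 p.2) (signMatrix x p.1 p.2)
      rw [abs_sub_comm] at h4
      linarith
    have h2 := abs_sub_round (E x p.1 p.2)
    have h3 : |((F x p : ℤ) : ℝ)| ≤ 3 * (m : ℝ) ^ 2 := by
      have h4 : |(round (E x p.1 p.2) : ℝ)| ≤ |E x p.1 p.2| +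
          |E x p.1 p.2 - round (E x p.1 p.2)| := by
        have := abs_sub_abs_le_abs_sub (round (E x p.1 p.2) : ℝ) (E x p.1 p.2)
        rw [abs_sub_comm] at this
        linarith
      have h5 : m * √(m : ℝ) ≤ m * m := by gcongr
      change |(round (E x p.1 p.2) : ℝ)| ≤ _
      nlinarith
    rw [abs_le] at h3
    simp only [I, Finset.mem_Icc]
    constructor
    · have := h3.1; rify; linarith
    · have := h3.2; rify; linarith
  have hFc : ∀ x, (Finset.univ.filter fun p => F x p ≠ 0).card ≤ s := by
    intro x
    refine le_trans (Finset.card_le_card fun p => ?_) (hE1 x)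
    simp only [Finset.mem_filter, Finset.mem_univ, true_and, F]
    intro h1 h2
    exact h1 (by rw [h2, round_zero])
  choose code hcode using fun x => exists_code (by simpa using hsm) (F x) (hF x) (hFc x)
  have hI : I.card = 6 * m ^ 2 + 1 := by
    simp only [I, Int.card_Icc]; omega
  -- Both `m` and `7` are at most `exp L`, and a code takes one of `m ^ 2 (6 m ^ 2 + 1) ≤ 7 m ^ 4`
  -- values for each of its `s` pairs; `5 s L ≤ m ^ 2 / 100000`.
  have hcodes : (Fintype.card (Fin s → (Fin m × Fin m) × I) : ℝ) ≤
      Real.exp (1 / 100000 * (m * m)) := by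
    simp only [Fintype.card_fun, Fintype.card_prod, Fintype.card_fin, Fintype.card_coe, hI]
    push_cast
    have h1 : (m : ℝ) * m * (6 * (m : ℝ) ^ 2 + 1) ≤ Real.exp (5 * L) := by
      have h2 : (m : ℝ) ≤ Real.exp L := by rwa [← Real.log_le_iff_le_exp hm']
      have h3 : 7 ≤ Real.exp L := by linarith [Real.add_one_le_exp L]
      have h4 : Real.exp (5 * L) = Real.exp L * Real.exp L ^ 4 := by
        rw [← Real.exp_nat_mul, ← Real.exp_add]; congr 1; push_cast; ring
      rw [h4]
      have h5 : 0 ≤ (m : ℝ) ^ 2 * ((m : ℝ) ^ 2 - 1) :=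
        mul_nonneg (by positivity) (by nlinarith)
      calc (m : ℝ) * m * (6 * (m : ℝ) ^ 2 + 1) ≤ 7 * (m : ℝ) ^ 4 := by nlinarith
        _ ≤ _ := by gcongr
    calc ((m : ℝ) * m * (6 * (m : ℝ) ^ 2 + 1)) ^ s ≤ Real.exp (5 * L) ^ s := by gcongr
      _ = Real.exp (s * (5 * L)) := by rw [← Real.exp_nat_mul]
      _ ≤ _ := by
        rw [Real.exp_le_exp]; nlinarith
  have hpos : 0 < (Fintype.card (Fin s → (Fin m × Fin m) × I) : ℝ) := by
    have : Nonempty (Fin s → (Fin m × Fin m) × I) := ⟨code fun _ => true⟩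
    exact_mod_cast Fintype.card_pos
  obtain ⟨φ, -, hφ⟩ := Finset.exists_le_card_fiber_of_nsmul_le_card_of_maps_to
    (s := (Finset.univ : Finset (Fin m × Fin m → Bool))) (t := Finset.univ) (f := code)
    (b := (2 : ℝ) ^ (m * m) / Fintype.card (Fin s → (Fin m × Fin m) × I))
    (fun _ _ => Finset.mem_univ _) ⟨code fun _ => true, Finset.mem_univ _⟩ (by
      rw [nsmul_eq_mul, Finset.card_univ, mul_div_cancel₀ _ hpos.ne']
      simp)
  set B := Finset.univ.filter fun x => code x = φ
  let E' : Matrix (Fin m) (Fin m) ℝ := of fun i j =>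
    ((∑ k, if (φ k).1 = (i, j) then ((φ k).2 : ℤ) else 0 : ℤ) : ℝ)
  have hB : ∀ b ∈ B, schattenNorm 1 (signMatrix b - E') ≤ 501 / 1000 * (m * √m) := by
    intro b hb
    have hb' : code b = φ := (Finset.mem_filter.1 hb).2
    have e1 : E' = (E b).map fun a => (round a : ℝ) := by
      ext i j
      have := hcode b (i, j)
      rw [hb'] at this
      simp only [E', of_apply, map_apply, ← this, F]
    have e2 : signMatrix b - E' = (signMatrix b - E b) + (E b - E') := by abel
    have h3 : √((nnz (E b) : ℝ) / 4) ≤ 1 / 1000 * m := by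
      rw [Real.sqrt_le_left (by positivity)]
      have : (nnz (E b) : ℝ) ≤ s := by exact_mod_cast hE1 b
      nlinarith
    have h4 : schattenNorm 1 (E b - E') ≤ 1 / 1000 * (m * √m) := by
      rw [e1]
      refine (nuclear_sub_round_le (E b)).trans ?_
      refine (mul_le_mul_of_nonneg_left h3 (Real.sqrt_nonneg _)).trans (le_of_eq ?_)
      ring
    rw [e2]
    refine (nuclear_add_le _ _).trans ?_
    linarith [hE2 b]
  have hcard : (2 : ℝ) ^ (m * m) ≤ B.card * Real.exp (1 / 100000 * (m * m)) := by
    rw [div_le_iff₀ hpos] at hφ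
    exact hφ.trans (by gcongr)
  -- With these parameters the upper bound is about `0.65 m √m`, below `(19 / 27) m √m`.
  have h1 := sum_nuclear_sub_le (c := 1 / 25) (β := 2 / 25) hm (by norm_num) (by norm_num) hcard hB
  have h2 := (sum_nuclear_signMatrix_ge hm).trans ((sum_nuclear_sub_ge E').trans h1)
  have h3 := le_of_mul_le_mul_left h2 (by positivity)
  have h4 : 0 < m * √(m : ℝ) := by positivity
  norm_num at h3
  linarith

theorem nnz_smul {m d : ℕ} {a : ℝ} (ha : a ≠ 0) (E : Matrix (Fin m) (Fin d) ℝ) :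
    nnz (a • E) = nnz E := by
  simp [nnz, ha]

/-- A contraction that is far from every sparse matrix. The distance is expressed by a dual
contraction `Y`, the form in which Hölder's inequality uses it. -/
theorem exists_contraction_far {m : ℕ} {L : ℝ} (hm : 0 < m) (hL : 6 ≤ L)
    (hmL : Real.log m ≤ L) :
    ∃ D : Matrix (Fin m) (Fin m) ℝ, IsContraction D ∧
      ∀ E : Matrix (Fin m) (Fin m) ℝ, nnz E * L ≤ 1 / 1000000 * (m : ℝ) ^ 2 →
        ∃ Y, IsContraction Y ∧ 1 / 4 * m < frob (D - E) Y := by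
  have hm' : (0 : ℝ) < m := by exact_mod_cast hm
  have hr : 0 < √(m : ℝ) := Real.sqrt_pos.2 hm'
  have hr2 : √(m : ℝ) * √m = m := Real.mul_self_sqrt hm'.le
  have hL0 : 0 < L := by linarith
  obtain ⟨x, hx⟩ := exists_signMatrix_far (s := ⌊1 / 1000000 * (m : ℝ) ^ 2 / L⌋₊) hm hL hmL (by
    rw [← le_div_iff₀ hL0]
    exact Nat.floor_le (by positivity))
  obtain ⟨D, hD, hclip⟩ := exists_clip (signMatrix x) hr
  refine ⟨D, hD, fun E hE => ?_⟩
  obtain ⟨Y, hY, h⟩ := exists_contraction_frob_eq (√m • D - √m • E)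
  refine ⟨Y, hY, ?_⟩
  have h1 := hx (√m • E) (by
    rw [nnz_smul hr.ne']
    exact Nat.le_floor (by rwa [le_div_iff₀ hL0]))
  have h2 : signMatrix x - √m • E = (signMatrix x - √m • D) + (√m • D - √m • E) := by abel
  rw [h2] at h1
  have h3 := h1.trans_le (nuclear_add_le _ _)
  rw [frob_signMatrix_self] at hclip
  have h4 : (m : ℝ) ^ 2 / (4 * √m) = 1 / 4 * (m * √m) := by
    field_simp
    rw [pow_two (√(m : ℝ)), hr2]
  rw [h4] at hclip
  rw [← h, ← smul_sub, frob_smul_left] at h3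
  have h5 : √(m : ℝ) * (1 / 4 * m) < √m * frob (D - E) Y := by nlinarith
  exact lt_of_mul_lt_mul_left h5 hr.le

/-! ### The block matrix and the choice of sizes -/

noncomputable section

/-- The inclusion of the coordinate subspace with coordinates `e`, as an `n × m` matrix. -/
def coordInclusion {m n : ℕ} (e : Fin m → Fin n) : Matrix (Fin n) (Fin m) ℝ :=
  (1 : Matrix (Fin n) (Fin n) ℝ).submatrix id e

end

theorem coordInclusion_transpose_mul {m t n : ℕ} (e : Fin m → Fin n) (f : Fin t → Fin n) :
    (coordInclusion e)ᵀ * coordInclusion f = (1 : Matrix (Fin n) (Fin n) ℝ).submatrix e f := by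
  ext a b
  simp [coordInclusion, mul_apply, one_apply, eq_comm]

theorem compress_eq_submatrix {m n : ℕ} (e : Fin m → Fin n) (X : Matrix (Fin n) (Fin n) ℝ) :
    (coordInclusion e)ᵀ * X * coordInclusion e = X.submatrix e e := by
  ext a b
  simp [coordInclusion, mul_apply, one_apply]

theorem frob_block {m n : ℕ} (e : Fin m → Fin n) (X : Matrix (Fin n) (Fin n) ℝ)
    (Y : Matrix (Fin m) (Fin m) ℝ) :
    frob X (coordInclusion e * Y * (coordInclusion e)ᵀ) = frob (X.submatrix e e) Y := by
  rw [← compress_eq_submatrix, frob, frob, ← Matrix.mul_assoc, trace_mul_comm]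
  simp only [transpose_mul, transpose_transpose, Matrix.mul_assoc]

theorem nnz_submatrix_le {m n : ℕ} {e : Fin m → Fin n} (he : Function.Injective e)
    (X : Matrix (Fin n) (Fin n) ℝ) : nnz (X.submatrix e e) ≤ nnz X := by
  refine Finset.card_le_card_of_injOn (fun p => (e p.1, e p.2)) (fun p hp => ?_) ?_
  · simpa using (Finset.mem_filter.1 hp).2
  · rintro ⟨a, b⟩ _ ⟨c, d⟩ _ h
    simp only [Prod.mk.injEq] at h
    rw [he h.1, he h.2]

theorem isDiag_coordInclusion_mul_transpose {m n : ℕ} (e : Fin m → Fin n) :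
    (coordInclusion e * (coordInclusion e)ᵀ).IsDiag := by
  intro i j hij
  rw [mul_apply]
  refine Finset.sum_eq_zero fun k _ => ?_
  simp only [coordInclusion, transpose_apply, submatrix_apply, id, one_apply]
  split_ifs with h1 h2
  · exact absurd (h1.trans h2.symm) hij
  all_goals simp

theorem nnz_le_of_isDiag {n : ℕ} {X : Matrix (Fin n) (Fin n) ℝ} (hX : X.IsDiag) : nnz X ≤ n := by
  calc nnz X ≤ (Finset.univ.image fun i : Fin n => (i, i)).card := by
        refine Finset.card_le_card fun p hp => ?_
        obtain ⟨i, j⟩ := p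
        simp only [Finset.mem_filter, Finset.mem_univ, true_and] at hp
        by_cases h : i = j
        · subst h; simp
        · exact absurd (hX h) hp
    _ ≤ n := by simpa using Finset.card_image_le (s := Finset.univ) (f := fun i : Fin n => (i, i))

/-- The matrix `D ⊕ a • 1` with `a = (m / t) ^ (1 / q)`. The scalar block is its sparse
approximation in `S_p`, while an approximation in `S_q` has about as many non-zero entries as `D`.
-/
theorem exists_separating_matrix {p q : ℝ≥0∞} (hp : 1 ≤ p) (hq : 1 ≤ q) {m t : ℕ} (hm : 0 < m)
    (ht : 0 < t) {L ε ε₀ : ℝ} (hL : 6 ≤ L) (hmL : Real.log m ≤ L) (hε : 0 ≤ ε)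
    (hε₀ : ε₀ ≤ 1 / 10)
    (hmt : ((m : ℝ) / t) ^ ((p⁻¹).toReal - (q⁻¹).toReal) ≤ ε) :
    ∃ A : Matrix (Fin (m + t)) (Fin (m + t)) ℝ,
      (∃ A', IsSchattenSparsifier ε p ((m + t : ℕ) : ℝ) A A') ∧
      ∀ A'', IsSchattenApprox ε₀ q A A'' → 1 / 1000000 * (m : ℝ) ^ 2 / L ≤ nnz A'' := by
  have hm' : (0 : ℝ) < m := by exact_mod_cast hm
  have ht' : (0 : ℝ) < t := by exact_mod_cast ht
  have hL0 : 0 < L := by linarith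
  obtain ⟨D, hD, hfar⟩ := exists_contraction_far hm hL hmL
  set α := (q⁻¹).toReal with hα
  set β := (p⁻¹).toReal with hβ
  let e : Fin m → Fin (m + t) := Fin.castAdd t
  let f : Fin t → Fin (m + t) := Fin.natAdd m
  have he : Function.Injective e := Fin.castAdd_injective m t
  have hf : Function.Injective f := Fin.natAdd_injective t m
  have hef : ∀ i k, e i ≠ f k := by
    intro i k h
    have := congrArg Fin.val h
    simp only [e, f, Fin.val_castAdd, Fin.val_natAdd] at this
    omega
  set J := coordInclusion e with hJdef
  set K := coordInclusion f with hKdef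
  have hJ : Jᵀ * J = 1 := by
    rw [hJdef, coordInclusion_transpose_mul, submatrix_one e he]
  have hK : Kᵀ * K = 1 := by
    rw [hKdef, coordInclusion_transpose_mul, submatrix_one f hf]
  have hJK : Jᵀ * K = 0 := by
    rw [hJdef, hKdef, coordInclusion_transpose_mul]
    ext i k
    simp [one_apply, hef]
  have hKJ : Kᵀ * J = 0 := by
    rw [← transpose_transpose (Kᵀ * J), transpose_mul, transpose_transpose, hJK, transpose_zero]
  set a : ℝ := (m / t : ℝ) ^ α with ha
  have ha0 : 0 ≤ a := by positivity
  set S : Matrix (Fin (m + t)) (Fin (m + t)) ℝ := K * (1 : Matrix (Fin t) (Fin t) ℝ) * Kᵀ with hS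
  set A : Matrix (Fin (m + t)) (Fin (m + t)) ℝ := (1 : ℝ) • (J * D * Jᵀ) + a • S with hA
  -- The compressions of `A` to the two blocks.
  have hAe : A.submatrix e e = D := by
    rw [← compress_eq_submatrix, ← hJdef, hA, hS]
    have h1 : Jᵀ * (J * D * Jᵀ) * J = D := by
      rw [← Matrix.mul_assoc, ← Matrix.mul_assoc, hJ, Matrix.one_mul, Matrix.mul_assoc, hJ,
        Matrix.mul_one]
    have h2 : Jᵀ * (K * (1 : Matrix (Fin t) (Fin t) ℝ) * Kᵀ) * J = 0 := by
      rw [← Matrix.mul_assoc, ← Matrix.mul_assoc, hJK]; simp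
    rw [Matrix.mul_add, Matrix.add_mul, one_smul, h1,
      Matrix.mul_smul, Matrix.smul_mul, h2, smul_zero, add_zero]
  have hAf : A.submatrix f f = a • 1 := by
    rw [← compress_eq_submatrix, ← hKdef, hA, hS]
    have h1 : Kᵀ * (J * D * Jᵀ) * K = 0 := by
      rw [← Matrix.mul_assoc, ← Matrix.mul_assoc, hKJ]; simp
    have h2 : Kᵀ * (K * (1 : Matrix (Fin t) (Fin t) ℝ) * Kᵀ) * K = 1 := by
      rw [← Matrix.mul_assoc, ← Matrix.mul_assoc, hK, Matrix.one_mul, Matrix.mul_assoc, hK,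
        Matrix.mul_one]
    rw [Matrix.mul_add, Matrix.add_mul, one_smul, h1,
      Matrix.mul_smul, Matrix.smul_mul, h2, zero_add]
  have haα : a * (t : ℝ) ^ α = (m : ℝ) ^ α := by
    rw [ha, Real.div_rpow hm'.le ht'.le]
    have : (t : ℝ) ^ α ≠ 0 := by positivity
    field_simp
  have hAp : a * (t : ℝ) ^ β ≤ schattenNorm p A := by
    have h1 := frob_le_schattenNorm hp hK isContraction_one A
    rw [hKdef, frob_block, hAf] at h1
    have h2 : frob (a • (1 : Matrix (Fin t) (Fin t) ℝ)) 1 = a * t := by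
      simp [frob]
    rw [h2, ← hβ] at h1
    have h3 : (t : ℝ) ^ (1 - β) * (a * (t : ℝ) ^ β) = a * t := by
      rw [mul_left_comm, ← Real.rpow_add ht', sub_add_cancel, Real.rpow_one]
    rw [← h3] at h1
    exact le_of_mul_le_mul_left h1 (by positivity)
  -- Both blocks contribute `m ^ (1 / q)`.
  have hAq : schattenNorm q A ≤ 2 * (m : ℝ) ^ α := by
    have h1 := schattenNorm_blocks_le hq hJ hK hD isContraction_one zero_le_one ha0
    rw [← hα, haα] at h1
    refine h1.trans (le_of_eq (by ring))
  refine ⟨A, ⟨a • S, ?_, ?_⟩, fun A'' hA'' => ?_⟩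
  · have h1 := schattenNorm_blocks_le hp hJ hK hD isContraction_one zero_le_one le_rfl
    rw [zero_smul, zero_mul, add_zero, add_zero, one_mul, ← hβ] at h1
    have h2 : A - a • S = (1 : ℝ) • (J * D * Jᵀ) := by rw [hA]; abel
    rw [IsSchattenApprox, h2]
    refine h1.trans (le_trans ?_ (mul_le_mul_of_nonneg_left hAp hε))
    have h3 : (m : ℝ) ^ β = ((m : ℝ) / t) ^ (β - α) * (a * (t : ℝ) ^ β) := by
      rw [ha, ← mul_assoc, ← Real.rpow_add (by positivity), sub_add_cancel,
        ← Real.mul_rpow (by positivity) ht'.le, div_mul_cancel₀ _ ht'.ne']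
    rw [h3]
    exact mul_le_mul_of_nonneg_right hmt (by positivity)
  · have h1 : (a • S).IsDiag := by
      rw [hS, Matrix.mul_one]
      exact (isDiag_coordInclusion_mul_transpose f).smul a
    exact_mod_cast nnz_le_of_isDiag h1
  · by_contra! hlt
    rw [lt_div_iff₀ hL0] at hlt
    have hle : (nnz (A''.submatrix e e) : ℝ) ≤ nnz A'' := by
      exact_mod_cast nnz_submatrix_le he A''
    obtain ⟨Y, hY, hYfar⟩ := hfar (A''.submatrix e e)
      ((mul_le_mul_of_nonneg_right hle hL0.le).trans hlt.le)
    -- Otherwise Hölder's inequality bounds `⟪D - E, Y⟫`, for the block `E` of the approximation, by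
    -- `(1 / 10) * 2 * m < m / 4`.
    have h1 := frob_le_schattenNorm hq hJ hY (A - A'')
    rw [hJdef, frob_block, submatrix_sub, Pi.sub_apply, Pi.sub_apply, hAe, ← hα] at h1
    have hmα : (m : ℝ) ^ (1 - α) * (m : ℝ) ^ α = m := by
      rw [← Real.rpow_add hm', sub_add_cancel, Real.rpow_one]
    have h2 : schattenNorm q (A - A'') ≤ 1 / 5 * (m : ℝ) ^ α := by
      have : 0 ≤ schattenNorm q A := by
        have : Fact (1 ≤ q) := ⟨hq⟩
        exact norm_nonneg _
      calc _ ≤ ε₀ * schattenNorm q A := hA''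
        _ ≤ 1 / 10 * schattenNorm q A := by gcongr
        _ ≤ _ := by linarith
    have h3 : (m : ℝ) ^ (1 - α) * schattenNorm q (A - A'') ≤ 1 / 5 * m := by
      refine (mul_le_mul_of_nonneg_left h2 (by positivity)).trans (le_of_eq ?_)
      rw [mul_left_comm, hmα]
    linarith

/-- Sizes `r` and `b = n - r` of the two blocks: `r = ⌊n / (2 L)⌋` has order `n / L`, and
`b ≥ n / 2` is at least `L * r`. -/
theorem exists_split {n : ℕ} {L : ℝ} (hL : 10 ≤ L) (hn : L = Real.logb 2 n) :
    ∃ r b : ℕ, n = r + b ∧ 0 < r ∧ r * L ≤ b ∧ n ≤ 4 * L * r := by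
  have hn0 : 0 < n := by
    rcases Nat.eq_zero_or_pos n with rfl | h
    · simp at hn; linarith
    · exact h
  have hn' : (0 : ℝ) < n := by exact_mod_cast hn0
  have hL0 : 0 < L := by linarith
  have h2L : 2 * L ≤ n := by
    have hlog : Real.log n = L * Real.log 2 := by
      rw [hn, Real.logb, div_mul_cancel₀]
      exact (Real.log_pos (by norm_num)).ne'
    have h1 := Real.quadratic_le_exp_of_nonneg (x := Real.log n)
      (by rw [hlog]; exact mul_nonneg hL0.le (Real.log_nonneg (by norm_num)))
    rw [Real.exp_log hn', hlog] at h1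
    have := Real.log_two_gt_d9
    have h3 : 6 / 10 * L ≤ L * Real.log 2 := by nlinarith
    nlinarith
  have hx1 : 1 ≤ n / (2 * L) := by rwa [one_le_div (by positivity)]
  set r := ⌊(n : ℝ) / (2 * L)⌋₊ with hr
  have hr1 : 1 ≤ r := Nat.le_floor (by exact_mod_cast hx1)
  have hr2 : (r : ℝ) * (2 * L) ≤ n := by
    rw [← le_div_iff₀ (by positivity)]; exact Nat.floor_le (by positivity)
  have hr3 : (n : ℝ) / (2 * L) < r + 1 := Nat.lt_floor_add_one _
  rw [div_lt_iff₀ (by positivity)] at hr3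
  have hr1' : (1 : ℝ) ≤ r := by exact_mod_cast hr1
  have hrn : r ≤ n := by
    have : (r : ℝ) ≤ n := by nlinarith
    exact_mod_cast this
  refine ⟨r, n - r, by omega, hr1, ?_, by nlinarith⟩
  rw [Nat.cast_sub hrn]
  nlinarith

/-- The admissible `ε` exist only for `L = log₂ n ≥ 10`, so no small `n` needs separate treatment.
-/
theorem ten_le_of_rpow_neg_lt {L δ : ℝ} (hL : 1 ≤ L) (h1 : δ ≤ 1)
    (h : L ^ (-δ) < 1 / 10) : 10 ≤ L := by
  have hL0 : 0 < L := by linarith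
  rw [Real.rpow_neg hL0.le, ← one_div, one_div_lt_one_div (by positivity) (by norm_num)] at h
  exact h.le.trans ((Real.rpow_le_rpow_of_exponent_le hL h1).trans (by rw [Real.rpow_one]))

theorem theorem2 (p q : ℝ≥0∞) (hp : 1 ≤ p) (hq : 1 ≤ q) (hpq : p ≠ q) :
    ∃ (C c : ℝ) (k : ℕ), 0 < C ∧ 0 < c ∧
      ∀ (n : ℕ) (ε ε₀ : ℝ), 2 ≤ n →
        (Real.logb 2 n) ^ (-|(q⁻¹).toReal - (p⁻¹).toReal|) < ε → ε ≤ ε₀ → ε₀ ≤ 1 / 10 →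
        ∃ A : Matrix (Fin n) (Fin n) ℝ,
          (∃ A' : Matrix (Fin n) (Fin n) ℝ, IsSchattenSparsifier ε p (C * n) A A') ∧
          ∀ A'' : Matrix (Fin n) (Fin n) ℝ, IsSchattenApprox ε₀ q A A'' →
            c * (n : ℝ) ^ 2 / (Real.logb 2 n) ^ k ≤ (nnz A'' : ℝ) := by
  refine ⟨1, 1 / 16000000, 3, one_pos, by norm_num, fun n ε ε₀ hn hε hεε₀ hε₀ => ?_⟩
  have hinv : ∀ s : ℝ≥0∞, 1 ≤ s → 0 ≤ (s⁻¹).toReal ∧ (s⁻¹).toReal ≤ 1 := fun s hs =>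
    ⟨ENNReal.toReal_nonneg, by
      simpa using ENNReal.toReal_mono ENNReal.one_ne_top (ENNReal.inv_le_one.2 hs)⟩
  have hfin : ∀ s : ℝ≥0∞, 1 ≤ s → s⁻¹ ≠ ∞ := fun s hs =>
    ((ENNReal.inv_le_one.2 hs).trans_lt ENNReal.one_lt_top).ne
  have hne : (q⁻¹).toReal ≠ (p⁻¹).toReal := fun h =>
    hpq (inv_injective ((ENNReal.toReal_eq_toReal_iff' (hfin q hq) (hfin p hp)).1 h)).symm
  obtain ⟨hp0, hp1⟩ := hinv p hp
  obtain ⟨hq0, hq1⟩ := hinv q hq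
  have hn' : (2 : ℝ) ≤ n := by exact_mod_cast hn
  obtain ⟨L, hLn⟩ : ∃ L, L = Real.logb 2 n := ⟨_, rfl⟩
  rw [← hLn] at hε ⊢
  have hL1 : 1 ≤ L := by
    rw [hLn, Real.le_logb_iff_rpow_le (by norm_num) (by linarith), Real.rpow_one]
    exact hn'
  have hL : 10 ≤ L := ten_le_of_rpow_neg_lt hL1
    (abs_le.2 ⟨by linarith, by linarith⟩) (hε.trans_le (hεε₀.trans hε₀))
  have hL0 : 0 < L := by linarith
  have hε0 : 0 ≤ ε := (Real.rpow_nonneg hL0.le _).trans hε.le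
  have hlogn : Real.log n ≤ L := by
    rw [hLn, Real.logb, le_div_iff₀ (Real.log_pos (by norm_num))]
    have := Real.log_nonneg (by linarith : (1 : ℝ) ≤ n)
    have := Real.log_two_lt_d9
    nlinarith
  obtain ⟨r, b, hrb, hr, hrL, hnr⟩ := exists_split hL hLn
  have hr' : (0 : ℝ) < r := by exact_mod_cast hr
  have hb' : (0 : ℝ) < b := lt_of_lt_of_le (by positivity) hrL
  have hb : 0 < b := by exact_mod_cast hb'
  have hratio : (r : ℝ) / b ≤ L⁻¹ := by
    rw [div_le_iff₀ hb', inv_mul_eq_div, le_div_iff₀ hL0]; exact hrL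
  have hsmall : ∀ δ : ℝ, 0 < δ → |(q⁻¹).toReal - (p⁻¹).toReal| = δ → ((r : ℝ) / b) ^ δ ≤ ε := by
    intro δ hδ h
    rw [h, Real.rpow_neg hL0.le, ← Real.inv_rpow hL0.le] at hε
    exact (Real.rpow_le_rpow (by positivity) hratio hδ.le).trans hε.le
  have hbound : ∀ m : ℕ, r ≤ m → 1 / 16000000 * (n : ℝ) ^ 2 / L ^ 3 ≤
      1 / 1000000 * (m : ℝ) ^ 2 / L := by
    intro m hm
    have hm' : (r : ℝ) ≤ m := by exact_mod_cast hm
    have h1 : (n : ℝ) ≤ 4 * L * m := hnr.trans (by gcongr)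
    have h2 : (n : ℝ) ^ 2 ≤ (4 * L * m) ^ 2 := by gcongr
    rw [div_le_div_iff₀ (by positivity) hL0]
    have h3 := mul_le_mul_of_nonneg_right h2 hL0.le
    nlinarith
  have hlog : ∀ m : ℕ, 0 < m → m ≤ n → Real.log m ≤ L := fun m h0 hm =>
    (Real.log_le_log (by exact_mod_cast h0) (by exact_mod_cast hm)).trans hlogn
  -- For `1 / q < 1 / p` the dense block is the small one; otherwise the scalar block is.
  rcases lt_or_gt_of_ne hne with h | h
  · have hA := exists_separating_matrix hp hq hr hb (by linarith) (hlog r hr (by omega)) hε0 hε₀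
      (hsmall _ (sub_pos.2 h) (by rw [abs_sub_comm, abs_of_pos (sub_pos.2 h)]))
    rw [← hrb] at hA
    obtain ⟨A, hA1, hA2⟩ := hA
    rw [one_mul]
    exact ⟨A, hA1, fun A'' h'' => (hbound r le_rfl).trans (hA2 A'' h'')⟩
  · have hrb' : r ≤ b := by
      have : (r : ℝ) ≤ b := by nlinarith
      exact_mod_cast this
    have hA := exists_separating_matrix hp hq hb hr (by linarith) (hlog b hb (by omega)) hε0 hε₀
      (by
        have := hsmall _ (sub_pos.2 h) (abs_of_pos (sub_pos.2 h))
        rwa [← inv_div, Real.inv_rpow (by positivity), ← Real.rpow_neg (by positivity),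
          neg_sub] at this)
    rw [add_comm b r, ← hrb] at hA
    obtain ⟨A, hA1, hA2⟩ := hA
    rw [one_mul]
    exact ⟨A, hA1, fun A'' h'' => (hbound b hrb').trans (hA2 A'' h'')⟩
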